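/- Let $\mathcal G$ be the star graph consisting of $N\ge 1$ half-lines $\mathbb R^+=(0,\infty)$ attached to a common vertex at $0$. Functions on $\mathcal G$ are vectors $\Psi=(\psi_1,\dots,\psi_N)$ of complex-valued functions on $\mathbb R^+$, with $\|\Psi\|_r^r=\sum_{j=1}^N\int_0^\infty|\psi_j|^r\,dx$ and $\|\cdot\|=\|\cdot\|_2$. Let $$\mathcal E=\{\Psi:\ \psi_j\in H^1(\mathbb R^+)\ \text{for all } j,\ \ \psi_1(0)=\dots=\psi_N(0)\},$$ and for $\mu>0$, $\omega>0$, $\alpha\in\mathbb R$ and $\Psi\in\mathcal E$ let $$S_\omega[\Psi]=\tfrac12\|\Psi'\|^2+\tfrac\omega2\|\Psi\|^2-\tfrac1{2\mu+2}\|\Psi\|_{2\mu+2}^{2\mu+2}+\tfrac\alpha2|\psi_1(0)|^2,$$ $$I_\omega[\Psi]=\|\Psi'\|^2+\omega\|\Psi\|^2-\|\Psi\|_{2\mu+2}^{2\mu+2}+\alpha|\psi_1(0)|^2 .$$ **Theorem.** Let $N\ge1$, $\mu>0$ and $\omega>0$. There exists $\alpha^*=\alpha^*(N,\mu,\omega)$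 with $-N\sqrt\omega<\alpha^*<0$, which for $N\ge3$ can be chosen as a solution of $$\int_0^1(1-t^2)^{1/\mu}\,dt=\frac N2\int_{|\alpha^*|/(N\sqrt\omega)}^1(1-t^2)^{1/\mu}\,dt,$$ such that for every $\alpha$ with $-N\sqrt\omega<\alpha<\alpha^*$ the action $S_\omega$ restricted to the Nehari manifold $\{\Phi\in\mathcal E:\ \Phi\neq0,\ I_\omega[\Phi]=0\}$ attains its infimum: there is $\Psi\in\mathcal E$, $\Psi\ne0$, with $I_\omega[\Psi]=0$ and $S_\omega[\Psi]=\min\{S_\omega[\Phi]:\ \Phi\in\mathcal E,\ \Phi\ne0,\ I_\omega[\Phi]=0\}$. -/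

import Mathlib

open MeasureTheory Set

noncomputable section

namespace StarGraph

/-- Lebesgue measure on the half-line `(0, ∞)`. -/
def halfLine : Measure ℝ := volume.restrict (Ioi 0)

/-- `v` is a weak derivative of `u` on `(0, ∞)`: integration by parts holds against all
smooth test functions with compact support in the open half-line. -/
def IsWeakDeriv (u v : ℝ → ℂ) : Prop :=
  ∀ η : ℝ → ℝ, ContDiff ℝ (⊤ : ℕ∞) η → HasCompactSupport η → tsupport η ⊆ Ioi 0 →
    ∫ x, u x * ((deriv η x : ℝ) : ℂ) ∂halfLine = -∫ x, v x * ((η x : ℝ) : ℂ) ∂halfLine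

/-- `u` is the representative, continuous up to the endpoint `0`, of an element of `H¹(ℝ⁺)`:
`u` is in `L²(ℝ⁺)` and has a weak derivative in `L²(ℝ⁺)`. Every class in `H¹(ℝ⁺)` has exactly
one such representative on `[0, ∞)`; its value at `0` is the value of the class at the vertex.
The values of `u` on the negative axis are irrelevant. -/
structure MemH1 (u : ℝ → ℂ) : Prop where
  continuousOn : ContinuousOn u (Ici 0)
  memLp : MemLp u 2 halfLine
  exists_weakDeriv : ∃ v : ℝ → ℂ, MemLp v 2 halfLine ∧ IsWeakDeriv u v

open Classical in
/-- The weak derivative in `L²(ℝ⁺)` (unique almost everywhere); `0` if there is none. -/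
def weakDeriv (u : ℝ → ℂ) : ℝ → ℂ :=
  if h : ∃ v : ℝ → ℂ, MemLp v 2 halfLine ∧ IsWeakDeriv u v then h.choose else 0

variable {N : ℕ}

/-- `‖Ψ‖_r ^ r = ∑ⱼ ∫₀^∞ |ψⱼ|^r` for a function on the star graph with `N` edges. -/
def normPow (r : ℝ) (Ψ : Fin N → ℝ → ℂ) : ℝ :=
  ∑ j, ∫ x, ‖Ψ j x‖ ^ r ∂halfLine

/-- The edgewise weak derivative `Ψ'`. -/
def gradient (Ψ : Fin N → ℝ → ℂ) : Fin N → ℝ → ℂ := fun j => weakDeriv (Ψ j)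

/-- The finite energy space: `Ψ ∈ H¹(𝓖)` with `ψ₁(0) = … = ψ_N(0)`. -/
def energySpace (N : ℕ) : Set (Fin N → ℝ → ℂ) :=
  {Ψ | (∀ j, MemH1 (Ψ j)) ∧ ∀ i j, Ψ i 0 = Ψ j 0}

/-- `Ψ` does not vanish identically on the star graph. -/
def IsNonzero (Ψ : Fin N → ℝ → ℂ) : Prop := ∃ j, ∃ x, 0 ≤ x ∧ Ψ j x ≠ 0

variable [NeZero N]

/-- The energy
`E[Ψ] = ½ ‖Ψ'‖² - ‖Ψ‖_{2μ+2}^{2μ+2} / (2μ+2) + (α/2) |ψ₁(0)|²`. -/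
def energy (α μ : ℝ) (Ψ : Fin N → ℝ → ℂ) : ℝ :=
  normPow 2 (gradient Ψ) / 2 - normPow (2 * μ + 2) Ψ / (2 * μ + 2) + α / 2 * ‖Ψ 0 0‖ ^ 2

/-- The action `S_ω[Ψ] = E[Ψ] + ω M[Ψ]`, where the mass is `M[Ψ] = ½ ‖Ψ‖²`. -/
def action (α μ ω : ℝ) (Ψ : Fin N → ℝ → ℂ) : ℝ :=
  energy α μ Ψ + ω * (normPow 2 Ψ / 2)

/-- `I_ω[Ψ] = ‖Ψ'‖² - ‖Ψ‖_{2μ+2}^{2μ+2} + ω ‖Ψ‖² + α |ψ₁(0)|²`. -/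
def nehariFunctional (α μ ω : ℝ) (Ψ : Fin N → ℝ → ℂ) : ℝ :=
  normPow 2 (gradient Ψ) - normPow (2 * μ + 2) Ψ + ω * normPow 2 Ψ + α * ‖Ψ 0 0‖ ^ 2

/-- The Nehari manifold `{Ψ ∈ 𝓔 : Ψ ≠ 0, I_ω[Ψ] = 0}`. -/
def nehari (N : ℕ) [NeZero N] (α μ ω : ℝ) : Set (Fin N → ℝ → ℂ) :=
  {Ψ | Ψ ∈ energySpace N ∧ IsNonzero Ψ ∧ nehariFunctional α μ ω Ψ = 0}

end StarGraph

end

noncomputable section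

namespace StarGraph

/-! On the Nehari manifold the action is maximal along each ray `t • Ψ` (`scaled_action_le`), so a
lower bound at one well-chosen `t` bounds the action of `Ψ` itself. Let W(r) = ωr²/2 -
r^(2μ+2)/(2μ+2), nonnegative for 0 ≤ r ≤ `height`. There |ψ'|²/2 + W(|ψ|) ≥ |ψ'|√(2W(|ψ|)), so an
edge costs at least the climb, measured by `cost`, from the vertex value to any value attained, plus
the descent to 0 (`two_mul_cost_sub_le`).

Write α = -aN√ω with 0 < a < 1. The half-soliton with vertex value s = `amplitude μ ω a` solves ψ' =
-√(2W(ψ)), which gives equality; copied on every edge it has action L = N cost(s) + αs²/2. For a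
competitor, increase `t` until the vertex modulus reaches s or the maximal modulus reaches `height`.
In the first case the bound is L. In the second it is 2 cost(height) + (N-2) cost(r) + αr²/2 with r
< s. This is at least L by monotonicity if N ≤ 2, and if N ≥ 3 as soon as L ≤ 2 cost(height),
because cost(r)/r² is antitone (`critical_le_of_le`). By `cost_amplitude_sub` that condition reads
(N/2)∫_a^1 ≤ ∫_0^1 for the integrand (1-t²)^(1/μ), with equality at the threshold. -/

/-! ### Test functions and weak derivatives on the half-line. -/

/-- A smooth compactly supported function on the open half-line. -/
structure IsTest (η : ℝ → ℝ) : Prop where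
  contDiff : ContDiff ℝ (⊤ : ℕ∞) η
  hasCompactSupport : HasCompactSupport η
  tsupport_subset : tsupport η ⊆ Ioi 0

theorem IsTest.exists_Icc {η : ℝ → ℝ} (h : IsTest η) :
    ∃ a b, 0 < a ∧ a < b ∧ ∀ x, x ∉ Icc a b → η x = 0 := by
  rcases (tsupport η).eq_empty_or_nonempty with he | hne
  · refine ⟨1, 2, by norm_num, by norm_num, fun x _ => ?_⟩
    rw [tsupport_eq_empty_iff] at he
    simp [he]
  · have hK : IsCompact (tsupport η) := h.hasCompactSupport
    have ha := hK.sInf_mem hne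
    refine ⟨sInf (tsupport η), sSup (tsupport η) + 1, h.tsupport_subset ha, ?_, fun x hx => ?_⟩
    · linarith [le_csSup hK.bddAbove ha]
    · apply image_eq_zero_of_notMem_tsupport
      intro hx'
      exact hx ⟨csInf_le hK.bddBelow hx', by linarith [le_csSup hK.bddAbove hx']⟩

theorem isTest_of_Icc {η : ℝ → ℝ} (h : ContDiff ℝ (⊤ : ℕ∞) η) {a b : ℝ} (ha : 0 < a)
    (h0 : ∀ x, x ∉ Icc a b → η x = 0) : IsTest η := by
  have hs : tsupport η ⊆ Icc a b := by
    apply closure_minimal _ isClosed_Icc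
    intro x hx
    by_contra hc
    exact hx (h0 x hc)
  refine ⟨h, ?_, fun x hx => lt_of_lt_of_le ha (hs hx).1⟩
  exact HasCompactSupport.of_support_subset_isCompact isCompact_Icc
    ((subset_tsupport _).trans hs)

theorem exists_isTest_integral_one : ∃ ρ : ℝ → ℝ, IsTest ρ ∧ ∫ x, ρ x = 1 := by
  let f : ContDiffBump (2 : ℝ) := ⟨1 / 2, 1, by norm_num, by norm_num⟩
  refine ⟨f.normed volume, ⟨f.contDiff_normed, f.hasCompactSupport_normed, ?_⟩,
    f.integral_normed⟩
  rw [f.tsupport_normed_eq]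
  intro x hx
  have : dist x 2 ≤ 1 := hx
  rw [Real.dist_eq, abs_le] at this
  simp only [mem_Ioi]; linarith

theorem IsTest.integrable {η : ℝ → ℝ} (h : IsTest η) : Integrable η :=
  h.contDiff.continuous.integrable_of_hasCompactSupport h.hasCompactSupport

theorem IsTest.sub {η ρ : ℝ → ℝ} (h : IsTest η) (hρ : IsTest ρ) (k : ℝ) :
    IsTest (fun x => η x - k * ρ x) := by
  obtain ⟨a, b, ha, hab, h0⟩ := h.exists_Icc
  obtain ⟨a', b', ha', hab', h0'⟩ := hρ.exists_Icc
  refine isTest_of_Icc (a := min a a') (b := max b b') ?_ (lt_min ha ha') ?_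
  · exact h.contDiff.sub (contDiff_const.mul hρ.contDiff)
  · intro x hx
    rw [h0, h0']
    · simp
    · exact fun hc => hx ⟨(min_le_right _ _).trans hc.1, hc.2.trans (le_max_right _ _)⟩
    · exact fun hc => hx ⟨(min_le_left _ _).trans hc.1, hc.2.trans (le_max_left _ _)⟩

/-- A test function of mean zero is the derivative of a test function. -/
theorem IsTest.exists_deriv_eq {q : ℝ → ℝ} (h : IsTest q) (h0 : ∫ x, q x = 0) :
    ∃ η, IsTest η ∧ deriv η = q := by
  obtain ⟨a, b, ha, hab, hz⟩ := h.exists_Icc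
  have hc := h.contDiff.continuous
  have hd : ∀ x, HasDerivAt (fun y => ∫ t in (a / 2)..y, q t) (q x) x := fun x =>
    intervalIntegral.integral_hasDerivAt_right (hc.intervalIntegrable _ _)
      (hc.stronglyMeasurableAtFilter _ _) hc.continuousAt
  have hder : deriv (fun y => ∫ t in (a / 2)..y, q t) = q := funext fun x => (hd x).deriv
  -- Starting strictly below `a` keeps all of `Icc a b` inside the half-open `Ioc (a / 2) x` once `b
  -- < x`.
  refine ⟨fun y => ∫ t in (a / 2)..y, q t,
    isTest_of_Icc (a := a / 2) (b := b) ?_ (by linarith) ?_, hder⟩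
  · rw [contDiff_infty_iff_deriv, hder]
    exact ⟨fun x => (hd x).differentiableAt, h.contDiff⟩
  · intro x hx
    rcases lt_or_ge x (a / 2) with hxa | hxa
    · rw [intervalIntegral.integral_symm, intervalIntegral.integral_of_le hxa.le, neg_eq_zero]
      exact setIntegral_eq_zero_of_forall_eq_zero fun t ht =>
        hz t fun hc => by linarith [hc.1, ht.2]
    · have hxb : b < x := by
        by_contra hcon
        exact hx ⟨hxa, not_lt.1 hcon⟩
      rw [intervalIntegral.integral_of_le hxa, ← h0]
      apply setIntegral_eq_integral_of_forall_compl_eq_zero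
      intro t ht
      exact hz t fun hc => ht ⟨by linarith [hc.1], by linarith [hc.2]⟩

theorem IsTest.integrableOn_mul {g w : ℝ → ℝ} (hg : IsTest g) (hw : ContinuousOn w (Ici 0)) :
    IntegrableOn (fun x => w x * g x) (Ioi 0) := by
  obtain ⟨a, b, ha, hab, hz⟩ := hg.exists_Icc
  have h1 : IntegrableOn (fun x => w x * g x) (Icc a b) := by
    apply ContinuousOn.integrableOn_Icc
    exact (hw.mono fun y hy => ha.le.trans hy.1).mul hg.contDiff.continuous.continuousOn
  exact h1.of_forall_sdiff_eq_zero measurableSet_Ioi fun y hy => by simp [hz y hy.2]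

theorem IsTest.deriv {η : ℝ → ℝ} (hη : IsTest η) : IsTest (deriv η) := by
  obtain ⟨a, b, ha, hab, hz⟩ := hη.exists_Icc
  refine isTest_of_Icc (contDiff_infty_iff_deriv.1 hη.contDiff).2 ha (b := b) fun x hx => ?_
  have : η =ᶠ[nhds x] fun _ => 0 := by
    filter_upwards [isClosed_Icc.isOpen_compl.mem_nhds hx] with y hy using hz y hy
  rw [this.deriv_eq]; simp

/-- Du Bois-Reymond: for a fixed `ρ` of mass one, `g - (∫ g) ρ` has mean zero, hence is the
derivative of a test function; so `w - c` annihilates every test function `g`. -/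
theorem eq_const_of_integral_mul_deriv_eq_zero {w : ℝ → ℝ} (hw : ContinuousOn w (Ici 0))
    (h : ∀ η, IsTest η → ∫ x in Ioi 0, w x * deriv η x = 0) {x : ℝ} (hx : 0 ≤ x) :
    w x = w 0 := by
  obtain ⟨ρ, hρ, hρ1⟩ := exists_isTest_integral_one
  set c := ∫ x in Ioi 0, w x * ρ x with hcdef
  have hloc : LocallyIntegrableOn w (Ioi 0) :=
    (hw.mono Ioi_subset_Ici_self).locallyIntegrableOn measurableSet_Ioi
  have hint := fun g (hg : IsTest g) => hg.integrableOn_mul hw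
  have hone : ∀ g, IsTest g → ∫ x in Ioi 0, g x = ∫ x, g x := by
    intro g hg
    apply setIntegral_eq_integral_of_forall_compl_eq_zero
    intro y hy
    exact image_eq_zero_of_notMem_tsupport fun hc => hy (hg.tsupport_subset hc)
  have hae : ∀ᵐ y, y ∈ Ioi (0:ℝ) → w y - c = 0 := by
    apply isOpen_Ioi.ae_eq_zero_of_integral_contDiff_smul_eq_zero
    · exact hloc.sub ((locallyIntegrable_const c).locallyIntegrableOn _)
    · intro g hg1 hg2 hg3
      have hg : IsTest g := ⟨hg1, hg2, hg3⟩
      set k := ∫ x, g x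
      have hq := hg.sub hρ k
      obtain ⟨η, hη, hηq⟩ := hq.exists_deriv_eq (by
        rw [integral_sub hg.integrable (hρ.integrable.const_mul k), integral_const_mul, hρ1]
        simp [k])
      have h1 := h η hη
      rw [hηq] at h1
      have h2 : ∫ x in Ioi 0, w x * g x = k * c := by
        rw [hcdef, ← integral_const_mul, ← sub_eq_zero,
          ← integral_sub (hint g hg) ((hint ρ hρ).const_mul k)]
        refine Eq.trans ?_ h1
        refine integral_congr_ae (Filter.Eventually.of_forall fun y => ?_)
        simp only; ring
      rw [← setIntegral_eq_integral_of_forall_compl_eq_zero (s := Ioi 0)]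
      · have : ∀ y, g y • (w y - c) = w y * g y - c * g y := fun y => by
          rw [smul_eq_mul]; ring
        simp_rw [this]
        rw [integral_sub (hint g hg) (hg.integrable.integrableOn.const_mul c),
          integral_const_mul, hone g hg, h2]
        ring
      · intro y hy
        rw [image_eq_zero_of_notMem_tsupport fun hc => hy (hg3 hc), zero_smul]
  have hall : ∀ y ∈ Ioi (0:ℝ), w y = c := by
    have := Measure.eqOn_open_of_ae_eq (μ := volume) (U := Ioi (0:ℝ)) (f := w) (g := fun _ => c)
      (by rw [Filter.EventuallyEq, ae_restrict_iff' measurableSet_Ioi]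
          filter_upwards [hae] with y hy hy'
          linarith [hy hy']) isOpen_Ioi
      (hw.mono Ioi_subset_Ici_self) continuousOn_const
    exact this
  have hcl : EqOn w (fun _ => c) (Ici 0) := by
    have : EqOn w (fun _ => c) (Ioi 0) := hall
    exact this.of_subset_closure hw continuousOn_const Ioi_subset_Ici_self (by simp)
  rw [hcl hx, hcl (mem_Ici.2 le_rfl)]

theorem integral_mul_deriv_of_isTest {g : ℝ → ℝ}
    (hg : ∀ a b, IntervalIntegrable g volume a b) {η : ℝ → ℝ} (hη : IsTest η) :
    ∫ x in Ioi 0, (∫ t in (0:ℝ)..x, g t) * deriv η x = -∫ x in Ioi 0, g x * η x := by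
  obtain ⟨a, b, ha, hab, hz⟩ := hη.exists_Icc
  have hb : 0 < b := ha.trans hab
  have hz' : ∀ x, x ∉ Icc a b → deriv η x = 0 := by
    intro x hx
    have : η =ᶠ[nhds x] fun _ => 0 := by
      filter_upwards [isClosed_Icc.isOpen_compl.mem_nhds hx] with y hy using hz y hy
    rw [this.deriv_eq]; simp
  -- Both `0` and `b + 1` lie outside `Icc a b`, so integration by parts on this interval has no
  -- boundary terms.
  have hred : ∀ F : ℝ → ℝ, (∀ x, x ∉ Icc a b → F x = 0) →
      ∫ x in Ioi 0, F x = ∫ x in (0:ℝ)..(b + 1), F x := by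
    intro F hF
    rw [intervalIntegral.integral_of_le (by linarith)]
    apply setIntegral_eq_of_subset_of_forall_sdiff_eq_zero measurableSet_Ioi Ioc_subset_Ioi_self
    intro x hx
    exact hF x fun hc => hx.2 ⟨hx.1, by linarith [hc.2]⟩
  rw [hred _ (fun x hx => by rw [hz' x hx, mul_zero]), hred _ (fun x hx => by rw [hz x hx, mul_zero])]
  have hP := (hg 0 (b + 1)).absolutelyContinuousOnInterval_intervalIntegral (c := 0) (by simp)
  have hE : AbsolutelyContinuousOnInterval η 0 (b + 1) :=
    (hη.contDiff.of_le (by exact_mod_cast le_top)).contDiffOn.absolutelyContinuousOnInterval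
  rw [hP.integral_mul_deriv_eq_deriv_mul hE, hz (b + 1) (fun hc => by linarith [hc.2]),
    hz 0 (fun hc => by linarith [hc.1])]
  have : ∫ x in (0:ℝ)..(b + 1), deriv (fun x => ∫ t in (0:ℝ)..x, g t) x * η x
      = ∫ x in (0:ℝ)..(b + 1), g x * η x := by
    apply intervalIntegral.integral_congr_ae
    filter_upwards [(hg 0 (b + 1)).ae_hasDerivAt_integral] with x hx hx'
    rw [(hx (uIoc_subset_uIcc hx') 0 (by simp)).deriv]
  rw [this]; simp

theorem eq_add_integral_of_weak {f g : ℝ → ℝ} (hf : ContinuousOn f (Ici 0))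
    (hg : ∀ a b, IntervalIntegrable g volume a b)
    (h : ∀ η, IsTest η → ∫ x in Ioi 0, f x * deriv η x = -∫ x in Ioi 0, g x * η x)
    {x : ℝ} (hx : 0 ≤ x) : f x = f 0 + ∫ t in (0:ℝ)..x, g t := by
  have hcont : ContinuousOn (fun x => ∫ t in (0:ℝ)..x, g t) (Ici 0) :=
    (intervalIntegral.continuous_primitive hg 0).continuousOn
  have := eq_const_of_integral_mul_deriv_eq_zero
    (w := fun x => f x - ∫ t in (0:ℝ)..x, g t) (hf.sub hcont) (fun η hη => by
      simp_rw [sub_mul]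
      rw [integral_sub (hη.deriv.integrableOn_mul hf) (hη.deriv.integrableOn_mul hcont), h η hη, integral_mul_deriv_of_isTest hg hη]
      ring) hx
  simp at this
  linarith

theorem integrable_mul_isTest {f : ℝ → ℂ} (hf : MemLp f 2 halfLine) {η : ℝ → ℝ} (hη : IsTest η) :
    Integrable (fun x => f x * ((η x : ℝ) : ℂ)) halfLine := by
  have h : MemLp (fun x => ((η x : ℝ) : ℂ)) 2 halfLine :=
    ((hη.contDiff.continuous.memLp_of_hasCompactSupport hη.hasCompactSupport).restrict _).ofReal
  exact hf.integrable_mul h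

theorem locallyIntegrable_indicator {v : ℝ → ℂ} (hv : MemLp v 2 halfLine) :
    LocallyIntegrable ((Ioi (0:ℝ)).indicator v) := by
  have : MemLp ((Ioi (0:ℝ)).indicator v) 2 volume :=
    (memLp_indicator_iff_restrict measurableSet_Ioi).2 hv
  exact this.locallyIntegrable (by norm_num)

theorem eq_add_integral_of_isWeakDeriv {u v : ℝ → ℂ} (hu : ContinuousOn u (Ici 0))
    (hu2 : MemLp u 2 halfLine) (hv : MemLp v 2 halfLine) (h : IsWeakDeriv u v)
    {x : ℝ} (hx : 0 ≤ x) : u x = u 0 + ∫ t in (0:ℝ)..x, (Ioi (0:ℝ)).indicator v t := by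
  set w := (Ioi (0:ℝ)).indicator v with hw
  have hwi : ∀ a b, IntervalIntegrable w volume a b := fun a b =>
    ((locallyIntegrable_indicator hv).integrableOn_isCompact isCompact_uIcc).intervalIntegrable
  have hwv : ∀ η : ℝ → ℝ, ∫ x in Ioi 0, w x * ((η x : ℝ) : ℂ) = ∫ x, v x * ((η x : ℝ) : ℂ) ∂halfLine := by
    intro η
    refine setIntegral_congr_fun measurableSet_Ioi fun y hy => ?_
    simp only [hw, indicator_of_mem hy]
  -- The real-valued result applies to every real-linear functional; real and imaginary parts
  -- suffice.
  have key : ∀ L : ℂ →L[ℝ] ℝ, L (u x) = L (u 0) + L (∫ t in (0:ℝ)..x, w t) := by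
    intro L
    have hL : ∀ (z : ℂ) (r : ℝ), L (z * (r : ℂ)) = L z * r := fun z r => by
      rw [mul_comm, ← Complex.real_smul, map_smul, smul_eq_mul, mul_comm]
    have := eq_add_integral_of_weak (f := fun x => L (u x)) (g := fun x => L (w x))
      (L.continuous.comp_continuousOn hu)
      (fun a b => ⟨L.integrable_comp (hwi a b).1, L.integrable_comp (hwi a b).2⟩)
      (fun η hη => by
        simp_rw [← hL]
        have h1 := integrable_mul_isTest hu2 hη.deriv
        have h2 : Integrable (fun x => w x * ((η x : ℝ) : ℂ)) (volume.restrict (Ioi 0)) := by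
          refine (integrable_mul_isTest hv hη).congr ?_
          filter_upwards [ae_restrict_mem measurableSet_Ioi] with y hy
          simp only [hw, indicator_of_mem hy]
        rw [halfLine] at h1
        rw [L.integral_comp_comm h1, L.integral_comp_comm h2, ← map_neg, hwv]
        congr 1
        exact h η hη.1 hη.2 hη.3) hx
    rw [this, L.intervalIntegral_comp_comm (hwi _ _)]
  apply Complex.ext
  · simpa using key Complex.reCLM
  · simpa using key Complex.imCLM

/-- Everything below uses only this control of the modulus, so |u| need not be differentiated. -/
theorem abs_norm_sub_norm_le {u v : ℝ → ℂ} (hu : ContinuousOn u (Ici 0))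
    (hu2 : MemLp u 2 halfLine) (hv : MemLp v 2 halfLine) (h : IsWeakDeriv u v)
    {x y : ℝ} (hx : 0 ≤ x) (hxy : x ≤ y) : |‖u y‖ - ‖u x‖| ≤ ∫ t in x..y, ‖v t‖ := by
  have hwi : ∀ a b, IntervalIntegrable ((Ioi (0:ℝ)).indicator v) volume a b := fun a b =>
    ((locallyIntegrable_indicator hv).integrableOn_isCompact isCompact_uIcc).intervalIntegrable
  have h1 : u y - u x = ∫ t in x..y, (Ioi (0:ℝ)).indicator v t := by
    rw [eq_add_integral_of_isWeakDeriv hu hu2 hv h (hx.trans hxy),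
      eq_add_integral_of_isWeakDeriv hu hu2 hv h hx,
      ← intervalIntegral.integral_add_adjacent_intervals (hwi 0 x) (hwi x y)]
    ring
  have h2 : ∫ t in x..y, (Ioi (0:ℝ)).indicator v t = ∫ t in x..y, v t := by
    apply intervalIntegral.integral_congr_ae
    refine Filter.Eventually.of_forall fun t ht => ?_
    rw [uIoc_of_le hxy] at ht
    exact indicator_of_mem (hx.trans_lt ht.1 : t ∈ Ioi 0) v
  calc |‖u y‖ - ‖u x‖| ≤ ‖u y - u x‖ := _root_.abs_norm_sub_norm_le _ _
    _ = ‖∫ t in x..y, v t‖ := by rw [h1, h2]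
    _ ≤ _ := intervalIntegral.norm_integral_le_integral_norm hxy

/-- Needed because `weakDeriv` is a choice: its norm can be computed from any explicit weak
derivative. -/
theorem IsWeakDeriv.ae_eq {u v w : ℝ → ℂ} (hv : MemLp v 2 halfLine) (hw : MemLp w 2 halfLine)
    (h : IsWeakDeriv u v) (h' : IsWeakDeriv u w) : v =ᵐ[halfLine] w := by
  have : ∀ᵐ y, y ∈ Ioi (0:ℝ) → (Ioi (0:ℝ)).indicator (v - w) y = 0 := by
    apply isOpen_Ioi.ae_eq_zero_of_integral_contDiff_smul_eq_zero
    · exact (locallyIntegrable_indicator (hv.sub hw)).locallyIntegrableOn _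
    · intro g h1 h2 h3
      have hg : IsTest g := ⟨h1, h2, h3⟩
      rw [← setIntegral_eq_integral_of_forall_compl_eq_zero (s := Ioi 0)]
      · have e := (h g h1 h2 h3).symm.trans (h' g h1 h2 h3)
        have hs := integral_sub (integrable_mul_isTest hv hg) (integrable_mul_isTest hw hg)
        rw [neg_injective e, sub_self] at hs
        rw [← hs]
        refine setIntegral_congr_fun measurableSet_Ioi fun y hy => ?_
        simp only [indicator_of_mem hy, Complex.real_smul, Pi.sub_apply]
        ring
      · intro y hy
        rw [indicator_of_notMem hy, smul_zero]
  rw [Filter.EventuallyEq, halfLine, ae_restrict_iff' measurableSet_Ioi]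
  filter_upwards [this] with y hy hy'
  have := hy hy'
  rw [indicator_of_mem hy'] at this
  exact sub_eq_zero.1 this

theorem weakDeriv_ae_eq {u v : ℝ → ℂ} (hv : MemLp v 2 halfLine) (h : IsWeakDeriv u v) :
    weakDeriv u =ᵐ[halfLine] v := by
  have hex : ∃ v : ℝ → ℂ, MemLp v 2 halfLine ∧ IsWeakDeriv u v := ⟨v, hv, h⟩
  rw [weakDeriv, dif_pos hex]
  exact IsWeakDeriv.ae_eq hex.choose_spec.1 hv hex.choose_spec.2 h

theorem MemH1.weakDeriv_spec {u : ℝ → ℂ} (h : MemH1 u) :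
    MemLp (weakDeriv u) 2 halfLine ∧ IsWeakDeriv u (weakDeriv u) := by
  rw [weakDeriv, dif_pos h.exists_weakDeriv]
  exact h.exists_weakDeriv.choose_spec

/-! ### Moduli with variation dominated by an `L²` function. -/

/-- Chain rule as an inequality for a function whose increments are dominated by `∫ g`. -/
theorem abs_comp_sub_comp_le {f g G W : ℝ → ℝ} {a b : ℝ} (hab : a ≤ b)
    (hf : ContinuousOn f (Icc a b)) (hg0 : ∀ x, 0 ≤ g x) (hg : IntervalIntegrable g volume a b)
    (hfg : ∀ x y, a ≤ x → x ≤ y → y ≤ b → |f y - f x| ≤ ∫ t in x..y, g t)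
    (hG : ∀ s, HasDerivAt G (W s) s) (hW : Continuous W) :
    |G (f b) - G (f a)| ≤ ∫ t in a..b, |W (f t)| * g t := by
  have hWf : ContinuousOn (fun x => |W (f x)|) (Icc a b) := (hW.comp_continuousOn hf).abs
  have hgi : ∀ x y, a ≤ x → x ≤ y → y ≤ b → IntervalIntegrable g volume x y := fun x y h1 h2 h3 =>
    hg.mono_set (by rw [uIcc_of_le h2, uIcc_of_le hab]; exact Icc_subset_Icc h1 h3)
  have hWgi : ∀ x y, a ≤ x → x ≤ y → y ≤ b →
      IntervalIntegrable (fun t => |W (f t)| * g t) volume x y := fun x y h1 h2 h3 =>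
    (hgi x y h1 h2 h3).continuousOn_mul
      (hWf.mono (by rw [uIcc_of_le h2]; exact Icc_subset_Icc h1 h3))
  -- On pieces of length at most `δ / 2` the weight `|W ∘ f|` oscillates by less than `ε`; the error
  -- `ε * ∫ g` is removed at the end.
  have key : ∀ ε > 0, |G (f b) - G (f a)| ≤ (∫ t in a..b, |W (f t)| * g t) + ε * ∫ t in a..b, g t := by
    intro ε hε
    obtain ⟨δ, hδ, hδ'⟩ := Metric.uniformContinuousOn_iff.1
      (isCompact_Icc.uniformContinuousOn_of_continuous hWf) ε hε
    have step : ∀ n : ℕ, ∀ x y, a ≤ x → x ≤ y → y ≤ b → y - x ≤ n * (δ / 2) →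
        |G (f y) - G (f x)| ≤ (∫ t in x..y, |W (f t)| * g t) + ε * ∫ t in x..y, g t := by
      intro n
      induction n with
      | zero =>
        intro x y h1 h2 h3 h4
        have : x = y := by simp at h4; linarith
        subst this; simp
      | succ n ih =>
        intro x y h1 h2 h3 h4
        set z := max x (y - δ / 2) with hz
        have hxz : x ≤ z := le_max_left _ _
        have hzy : z ≤ y := max_le h2 (by linarith)
        have hyz : y - z ≤ δ / 2 := by linarith [le_max_right x (y - δ / 2)]
        have hA := ih x z h1 hxz (hzy.trans h3) (by
          push_cast at h4
          rcases max_cases x (y - δ / 2) with h | h <;> rw [hz, h.1]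
          · simp; positivity
          · linarith)
        have haz := h1.trans hxz
        have hB : |G (f y) - G (f z)| ≤ (∫ t in z..y, |W (f t)| * g t) + ε * ∫ t in z..y, g t := by
          -- The mean value theorem for `G` gives a point between `f z` and `f y`; the intermediate
          -- value theorem writes it as `f q`.
          obtain ⟨q, hq, hqe⟩ : ∃ q ∈ Icc z y, |G (f y) - G (f z)| ≤ |W (f q)| * |f y - f z| := by
            have hfc : ContinuousOn f (uIcc z y) := hf.mono (by
              rw [uIcc_of_le hzy]; exact Icc_subset_Icc haz h3)
            have hiv := intermediate_value_uIcc hfc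
            rcases lt_trichotomy (f z) (f y) with hlt | heq | hlt
            · obtain ⟨ξ, hξ, he⟩ := exists_hasDerivAt_eq_slope G W hlt
                (fun s _ => (hG s).continuousAt.continuousWithinAt) (fun s _ => hG s)
              obtain ⟨q, hq, rfl⟩ := hiv (by
                rw [uIcc_of_le hlt.le]; exact Ioo_subset_Icc_self hξ)
              refine ⟨q, by rwa [uIcc_of_le hzy] at hq, ?_⟩
              rw [he, ← abs_mul, div_mul_cancel₀ _ (sub_ne_zero.2 hlt.ne')]
            · exact ⟨z, ⟨le_rfl, hzy⟩, by simp [heq]⟩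
            · obtain ⟨ξ, hξ, he⟩ := exists_hasDerivAt_eq_slope G W hlt
                (fun s _ => (hG s).continuousAt.continuousWithinAt) (fun s _ => hG s)
              obtain ⟨q, hq, rfl⟩ := hiv (by
                rw [uIcc_of_ge hlt.le]; exact Ioo_subset_Icc_self hξ)
              refine ⟨q, by rwa [uIcc_of_le hzy] at hq, ?_⟩
              rw [he, abs_sub_comm, abs_sub_comm (f y), ← abs_mul,
                div_mul_cancel₀ _ (sub_ne_zero.2 hlt.ne')]
          refine hqe.trans ((mul_le_mul_of_nonneg_left (hfg z y haz hzy h3) (abs_nonneg _)).trans ?_)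
          rw [← intervalIntegral.integral_const_mul, ← intervalIntegral.integral_const_mul,
            ← intervalIntegral.integral_add (hWgi z y haz hzy h3) ((hgi z y haz hzy h3).const_mul ε)]
          apply intervalIntegral.integral_mono_on hzy ((hgi z y haz hzy h3).const_mul _)
            ((hWgi z y haz hzy h3).add ((hgi z y haz hzy h3).const_mul ε))
          intro t ht
          rw [← add_mul]
          apply mul_le_mul_of_nonneg_right _ (hg0 t)
          have := hδ' q ⟨haz.trans hq.1, hq.2.trans h3⟩ t ⟨haz.trans ht.1, ht.2.trans h3⟩ (by
            rw [Real.dist_eq, abs_lt]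
            constructor <;> linarith [hq.1, hq.2, ht.1, ht.2])
          rw [Real.dist_eq] at this
          linarith [(abs_lt.1 this).2]
        rw [← intervalIntegral.integral_add_adjacent_intervals
            (hWgi x z h1 hxz (hzy.trans h3)) (hWgi z y haz hzy h3),
          ← intervalIntegral.integral_add_adjacent_intervals
            (hgi x z h1 hxz (hzy.trans h3)) (hgi z y haz hzy h3)]
        have := abs_sub_le (G (f y)) (G (f z)) (G (f x))
        linarith
    obtain ⟨n, hn⟩ := exists_nat_ge ((b - a) / (δ / 2))
    exact step n a b le_rfl hab le_rfl (by rwa [div_le_iff₀ (by positivity)] at hn)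
  have hI : 0 ≤ ∫ t in a..b, g t := intervalIntegral.integral_nonneg hab fun t _ => hg0 t
  apply le_of_forall_pos_le_add
  intro e he
  refine (key (e / ((∫ t in a..b, g t) + 1)) (by positivity)).trans ?_
  gcongr
  rw [div_mul_eq_mul_div, div_le_iff₀ (by positivity)]
  nlinarith

/-- `f` and `g` are nonnegative functions in `L²(0, ∞)`, `f` is continuous on `[0, ∞)` and its
increments are dominated by integrals of `g`. The model case is `f = |u|`, `g = |u'|`. -/
structure DominatedVariation (f g : ℝ → ℝ) : Prop where
  continuousOn : ContinuousOn f (Ici 0)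
  nonneg : ∀ x, 0 ≤ f x
  nonneg_right : ∀ x, 0 ≤ g x
  memLp : MemLp f 2 halfLine
  memLp_right : MemLp g 2 halfLine
  abs_sub_le : ∀ x y, 0 ≤ x → x ≤ y → |f y - f x| ≤ ∫ t in x..y, g t

theorem MemH1.dominatedVariation {u : ℝ → ℂ} (h : MemH1 u) :
    DominatedVariation (fun x => ‖u x‖) (fun x => ‖weakDeriv u x‖) where
  continuousOn := h.continuousOn.norm
  nonneg _ := norm_nonneg _
  nonneg_right _ := norm_nonneg _
  memLp := h.memLp.norm
  memLp_right := h.weakDeriv_spec.1.norm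
  abs_sub_le _ _ hx hxy :=
    abs_norm_sub_norm_le h.continuousOn h.memLp h.weakDeriv_spec.1 h.weakDeriv_spec.2 hx hxy

namespace DominatedVariation

variable {f g : ℝ → ℝ}

theorem const_mul (h : DominatedVariation f g) {t : ℝ} (ht : 0 ≤ t) :
    DominatedVariation (fun x => t * f x) (fun x => t * g x) where
  continuousOn := continuousOn_const.mul h.continuousOn
  nonneg x := mul_nonneg ht (h.nonneg x)
  nonneg_right x := mul_nonneg ht (h.nonneg_right x)
  memLp := h.memLp.const_mul t
  memLp_right := h.memLp_right.const_mul t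
  abs_sub_le x y hx hxy := by
    rw [← mul_sub, abs_mul, abs_of_nonneg ht, intervalIntegral.integral_const_mul]
    exact mul_le_mul_of_nonneg_left (h.abs_sub_le x y hx hxy) ht

theorem intervalIntegrable_right (h : DominatedVariation f g) {a b : ℝ} (ha : 0 ≤ a)
    (hab : a ≤ b) : IntervalIntegrable g volume a b := by
  rw [intervalIntegrable_iff_integrableOn_Ioc_of_le hab]
  have : MemLp g 2 (volume.restrict (Ioc a b)) :=
    h.memLp_right.mono_measure (Measure.restrict_mono
      (fun x hx => ha.trans_lt hx.1) le_rfl)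
  exact this.integrable (by norm_num)

theorem abs_comp_sub_le (h : DominatedVariation f g) {G W : ℝ → ℝ}
    (hG : ∀ s, HasDerivAt G (W s) s) (hW : Continuous W) {a b : ℝ} (ha : 0 ≤ a) (hab : a ≤ b) :
    |G (f b) - G (f a)| ≤ ∫ t in a..b, |W (f t)| * g t :=
  abs_comp_sub_comp_le hab (h.continuousOn.mono fun _ hx => ha.trans hx.1) h.nonneg_right
    (h.intervalIntegrable_right ha hab)
    (fun x y hx hxy _ => h.abs_sub_le x y (ha.trans hx) hxy) hG hW

theorem integrable_sq (h : DominatedVariation f g) : Integrable (fun x => f x ^ 2) halfLine :=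
  h.memLp.integrable_sq

/-- Beyond `X` the variation of `f²` is at most the tail of `∫ 2fg`. Since `f²` is integrable it is
small at some point `x > X`, hence at all later points. -/
theorem exists_forall_ge_lt (h : DominatedVariation f g) {δ : ℝ} (hδ : 0 < δ) :
    ∃ X, 0 ≤ X ∧ ∀ y, X ≤ y → f y < δ := by
  have hi : IntegrableOn (fun x => |2 * f x| * g x) (Ioi 0) := by
    have := (h.memLp.const_mul 2).norm.integrable_mul h.memLp_right
    exact this
  have hT := tendsto_integral_Ioi_zero (f := fun x => |2 * f x| * g x) (μ := volume)
    (b := fun x : ℝ => x) (l := Filter.atTop) Filter.tendsto_id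
  obtain ⟨X, hX⟩ := ((hT.eventually_lt_const (show (0:ℝ) < δ ^ 2 / 2 by positivity)).and
    (Filter.eventually_ge_atTop 0)).exists
  obtain ⟨x, hx, hxf⟩ : ∃ x, X < x ∧ f x ^ 2 < δ ^ 2 / 2 := by
    by_contra! hcon
    have h1 : IntegrableOn (fun _ => δ ^ 2 / 2) (Ioi X) (volume : Measure ℝ) := by
      have h2 : IntegrableOn (fun x => f x ^ 2) (Ioi X) :=
        IntegrableOn.mono_set h.integrable_sq (Ioi_subset_Ioi hX.2)
      refine Integrable.mono' h2 aestronglyMeasurable_const ?_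
      filter_upwards [ae_restrict_mem measurableSet_Ioi] with x hx
      rw [Real.norm_of_nonneg (by positivity)]
      exact hcon x hx
    rw [integrableOn_const_iff] at h1
    simp [hδ.ne'] at h1
  refine ⟨x, hX.2.trans hx.le, fun y hy => ?_⟩
  have h1 := h.abs_comp_sub_le (G := fun s => s ^ 2) (W := fun s => 2 * s)
    (fun s => by simpa using hasDerivAt_pow 2 s) (by fun_prop) (hX.2.trans hx.le) hy
  have h2 : ∫ t in x..y, |2 * f t| * g t ≤ ∫ t in Ioi X, |2 * f t| * g t := by
    rw [intervalIntegral.integral_of_le hy]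
    apply setIntegral_mono_set (hi.mono_set (Ioi_subset_Ioi hX.2))
    · exact Filter.Eventually.of_forall fun t => mul_nonneg (abs_nonneg _) (h.nonneg_right t)
    · exact (show Ioc x y ⊆ Ioi X from fun t ht => hx.trans ht.1).eventuallyLE
  have h3 := (abs_le.1 h1).2
  have h4 := hX.1
  exact lt_of_pow_lt_pow_left₀ 2 hδ.le (by linarith)

theorem tendsto_zero (h : DominatedVariation f g) :
    Filter.Tendsto f Filter.atTop (nhds 0) := by
  rw [Metric.tendsto_atTop]
  intro ε hε
  obtain ⟨X, _, hX⟩ := h.exists_forall_ge_lt hε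
  refine ⟨X, fun y hy => ?_⟩
  rw [Real.dist_eq, sub_zero, abs_of_nonneg (h.nonneg y)]
  exact hX y hy

theorem exists_max (h : DominatedVariation f g) : ∃ x, 0 ≤ x ∧ ∀ y, 0 ≤ y → f y ≤ f x := by
  by_cases h0 : ∃ x, 0 ≤ x ∧ 0 < f x
  · obtain ⟨x, hx, hfx⟩ := h0
    obtain ⟨X, hX, hX'⟩ := h.exists_forall_ge_lt hfx
    have hxX : x ≤ X := by
      by_contra! hc
      exact lt_irrefl _ (hX' x hc.le)
    obtain ⟨z, hz, hmax⟩ := isCompact_Icc.exists_isMaxOn ⟨x, hx, hxX⟩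
      (h.continuousOn.mono (Icc_subset_Ici_self : Icc 0 X ⊆ Ici 0))
    refine ⟨z, hz.1, fun y hy => ?_⟩
    rcases le_total y X with hyX | hyX
    · exact hmax ⟨hy, hyX⟩
    · exact (hX' y hyX).le.trans (hmax ⟨hx, hxX⟩)
  · push Not at h0
    exact ⟨0, le_rfl, fun y hy => (h0 y hy).trans (h.nonneg 0)⟩

theorem integrable_rpow (h : DominatedVariation f g) {p : ℝ} (hp : 2 ≤ p) :
    Integrable (fun x => f x ^ p) halfLine := by
  obtain ⟨x, hx, hmax⟩ := h.exists_max
  refine Integrable.mono' (h.integrable_sq.const_mul (f x ^ (p - 2)))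
    (h.memLp.1.aemeasurable.pow_const p).aestronglyMeasurable ?_
  filter_upwards [ae_restrict_mem measurableSet_Ioi] with y hy
  rw [Real.norm_of_nonneg (Real.rpow_nonneg (h.nonneg y) _)]
  rcases (h.nonneg y).eq_or_lt with h0 | h0
  · rw [← h0, Real.zero_rpow (by linarith)]; simp
  · have : f y ^ p = f y ^ (p - 2) * f y ^ 2 := by
      rw [← Real.rpow_natCast, ← Real.rpow_add h0]; norm_num
    rw [this]
    gcongr
    exact hmax y (le_of_lt hy)

end DominatedVariation

/-! ### The cost function and the lower bound on one edge. -/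

/-- `√2` times the square root of the potential energy density `ω r² / 2 - r ^ (2μ+2) / (2μ+2)`. -/
def slope (μ ω r : ℝ) : ℝ := r * √(ω - r ^ (2 * μ) / (μ + 1))

/-- The primitive of `slope` vanishing at `0`. -/
def cost (μ ω s : ℝ) : ℝ := ∫ r in (0:ℝ)..s, slope μ ω r

/-- The height of the soliton on the line. -/
def height (μ ω : ℝ) : ℝ := ((μ + 1) * ω) ^ (1 / (2 * μ))

section

variable {μ ω : ℝ}

theorem continuous_slope (hμ : 0 < μ) : Continuous (slope μ ω) := by
  have : Continuous fun r : ℝ => r ^ (2 * μ) := Real.continuous_rpow_const (by positivity)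
  unfold slope
  fun_prop

theorem hasDerivAt_cost (hμ : 0 < μ) (s : ℝ) : HasDerivAt (cost μ ω) (slope μ ω s) s :=
  intervalIntegral.integral_hasDerivAt_right ((continuous_slope hμ).intervalIntegrable _ _)
    ((continuous_slope hμ).stronglyMeasurableAtFilter _ _) (continuous_slope hμ).continuousAt

theorem continuous_cost (hμ : 0 < μ) : Continuous (cost μ ω) :=
  continuous_iff_continuousAt.2 fun s => (hasDerivAt_cost hμ s).continuousAt

@[simp] theorem cost_zero : cost μ ω 0 = 0 := by simp [cost]

theorem slope_nonneg {r : ℝ} (hr : 0 ≤ r) : 0 ≤ slope μ ω r :=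
  mul_nonneg hr (Real.sqrt_nonneg _)

theorem cost_le_cost (hμ : 0 < μ) {r s : ℝ} (hr : 0 ≤ r) (hrs : r ≤ s) :
    cost μ ω r ≤ cost μ ω s := by
  have h := intervalIntegral.integral_add_adjacent_intervals
    ((continuous_slope (ω := ω) hμ).intervalIntegrable (μ := volume) 0 r)
    ((continuous_slope (ω := ω) hμ).intervalIntegrable r s)
  have h' : 0 ≤ ∫ x in r..s, slope μ ω x :=
    intervalIntegral.integral_nonneg hrs fun t ht => slope_nonneg (hr.trans ht.1)
  unfold cost
  linarith

theorem height_pos (hμ : 0 < μ) (hω : 0 < ω) : 0 < height μ ω :=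
  Real.rpow_pos_of_pos (by positivity) _

theorem height_rpow (hμ : 0 < μ) (hω : 0 < ω) : height μ ω ^ (2 * μ) = (μ + 1) * ω := by
  rw [height, ← Real.rpow_mul (by positivity), one_div_mul_cancel (by positivity), Real.rpow_one]

theorem rpow_two_mul_add_two {r : ℝ} (hr : 0 ≤ r) (hμ : 0 < μ) :
    r ^ (2 * μ + 2) = r ^ (2 * μ) * r ^ 2 := by
  rw [Real.rpow_add_of_nonneg hr (by positivity) (by norm_num)]
  norm_num

/-- Past `height` the radicand is negative and `√` returns 0, so the identity fails there; hence the
height bound on all states to be estimated. -/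
theorem slope_sq (hμ : 0 < μ) (hω : 0 < ω) {r : ℝ} (hr : 0 ≤ r) (hrm : r ≤ height μ ω) :
    slope μ ω r ^ 2 / 2 = ω * r ^ 2 / 2 - r ^ (2 * μ + 2) / (2 * μ + 2) := by
  have h1 : r ^ (2 * μ) ≤ (μ + 1) * ω := by
    rw [← height_rpow hμ hω]
    exact Real.rpow_le_rpow hr hrm (by positivity)
  rw [slope, mul_pow, Real.sq_sqrt, rpow_two_mul_add_two hr hμ]
  · field_simp
  · rw [sub_nonneg, div_le_iff₀ (by positivity)]; linarith

/-- `s ↦ cost s / s²` is antitone. -/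
theorem sq_mul_cost_le (hμ : 0 < μ) {r s : ℝ} (hr : 0 ≤ r) (hrs : r ≤ s) :
    r ^ 2 * cost μ ω s ≤ s ^ 2 * cost μ ω r := by
  -- Rescaling to [0, 1] leaves an integrand whose quotient by `t` is q√(ω - (tq)^(2μ)/(μ+1)),
  -- decreasing in `t`.
  have h : ∀ t : ℝ, cost μ ω t = t * ∫ q in (0:ℝ)..1, slope μ ω (t * q) := by
    intro t
    rw [← smul_eq_mul, intervalIntegral.smul_integral_comp_mul_left]
    simp [cost]
  have hc : ∀ t : ℝ, IntervalIntegrable (fun q => slope μ ω (t * q)) volume 0 1 := fun t =>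
    ((continuous_slope hμ).comp (continuous_const.mul continuous_id)).intervalIntegrable _ _
  have key : r * ∫ q in (0:ℝ)..1, slope μ ω (s * q) ≤ s * ∫ q in (0:ℝ)..1, slope μ ω (r * q) := by
    rw [← intervalIntegral.integral_const_mul, ← intervalIntegral.integral_const_mul]
    apply intervalIntegral.integral_mono_on zero_le_one ((hc s).const_mul r) ((hc r).const_mul s)
    intro q hq
    have : √(ω - (s * q) ^ (2 * μ) / (μ + 1)) ≤ √(ω - (r * q) ^ (2 * μ) / (μ + 1)) := by
      apply Real.sqrt_le_sqrt
      gcongr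
      · exact mul_nonneg hr hq.1
      · exact hq.1
    have h2 : 0 ≤ r * s * q := mul_nonneg (mul_nonneg hr (hr.trans hrs)) hq.1
    unfold slope
    nlinarith [mul_le_mul_of_nonneg_left this h2]
  rw [h r, h s]
  have := mul_le_mul_of_nonneg_left key (mul_nonneg hr (hr.trans hrs))
  nlinarith

/-- The energy of a function on a half-line is bounded below by the cost of climbing from the
vertex value to the value at any point and of coming down to `0`. -/
theorem DominatedVariation.two_mul_cost_sub_le {f g : ℝ → ℝ} (h : DominatedVariation f g)
    (hμ : 0 < μ) (hω : 0 < ω) (hm : ∀ x, 0 ≤ x → f x ≤ height μ ω) {z : ℝ} (hz : 0 ≤ z) :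
    2 * cost μ ω (f z) - cost μ ω (f 0) ≤
      (∫ x, g x ^ 2 ∂halfLine) / 2 + ω * (∫ x, f x ^ 2 ∂halfLine) / 2
        - (∫ x, f x ^ (2 * μ + 2) ∂halfLine) / (2 * μ + 2) := by
  have hp : (2:ℝ) ≤ 2 * μ + 2 := by linarith
  have i1 := h.memLp_right.integrable_sq
  have i2 := h.integrable_sq
  have i3 := h.integrable_rpow hp
  have hE : (∫ x, g x ^ 2 ∂halfLine) / 2 + ω * (∫ x, f x ^ 2 ∂halfLine) / 2
        - (∫ x, f x ^ (2 * μ + 2) ∂halfLine) / (2 * μ + 2) =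
      ∫ x, (g x ^ 2 / 2 + ω * f x ^ 2 / 2 - f x ^ (2 * μ + 2) / (2 * μ + 2)) ∂halfLine := by
    rw [integral_sub, integral_add, integral_div, integral_div, integral_div, integral_const_mul]
    · exact i1.div_const 2
    · exact (i2.const_mul ω).div_const 2
    · exact (i1.div_const 2).add ((i2.const_mul ω).div_const 2)
    · exact i3.div_const _
  have iE : Integrable
      (fun x => g x ^ 2 / 2 + ω * f x ^ 2 / 2 - f x ^ (2 * μ + 2) / (2 * μ + 2)) halfLine :=
    ((i1.div_const 2).add ((i2.const_mul ω).div_const 2)).sub (i3.div_const _)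
  rw [hE]
  have hpt : ∀ x, 0 ≤ x → |slope μ ω (f x)| * g x ≤
      g x ^ 2 / 2 + ω * f x ^ 2 / 2 - f x ^ (2 * μ + 2) / (2 * μ + 2) := by
    intro x hx
    have := slope_sq hμ hω (h.nonneg x) (hm x hx)
    rw [abs_of_nonneg (slope_nonneg (h.nonneg x))]
    nlinarith [sq_nonneg (slope μ ω (f x) - g x)]
  have iS : IntegrableOn (fun x => |slope μ ω (f x)| * g x) (Ioi 0) := by
    refine Integrable.mono' iE ?_ ?_
    · have h1 : AEStronglyMeasurable (fun x => slope μ ω (f x)) halfLine :=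
        (continuous_slope hμ).comp_aestronglyMeasurable h.memLp.1
      exact h1.norm.mul h.memLp_right.1
    · filter_upwards [ae_restrict_mem measurableSet_Ioi] with x hx
      rw [Real.norm_of_nonneg (mul_nonneg (abs_nonneg _) (h.nonneg_right x))]
      exact hpt x (le_of_lt hx)
  -- Climb on [0, z], descent on [z, y]; then `y → ∞` makes the last cost vanish.
  have hfin : ∀ y, z ≤ y → 2 * cost μ ω (f z) - cost μ ω (f 0) - cost μ ω (f y) ≤
      ∫ x in Ioi 0, |slope μ ω (f x)| * g x := by
    intro y hy
    have a1 := (abs_le.1 (h.abs_comp_sub_le (hasDerivAt_cost (ω := ω) hμ) (continuous_slope hμ)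
      le_rfl hz)).2
    have a2 := (abs_le.1 (h.abs_comp_sub_le (hasDerivAt_cost (ω := ω) hμ) (continuous_slope hμ)
      hz hy)).1
    have a3 : (∫ t in (0:ℝ)..z, |slope μ ω (f t)| * g t) + ∫ t in z..y, |slope μ ω (f t)| * g t ≤
        ∫ x in Ioi 0, |slope μ ω (f x)| * g x := by
      have hi : ∀ a b, 0 ≤ a → a ≤ b →
          IntervalIntegrable (fun x => |slope μ ω (f x)| * g x) volume a b := fun a b ha hab =>
        (intervalIntegrable_iff_integrableOn_Ioc_of_le hab).2
          (iS.mono_set fun x hx => ha.trans_lt hx.1)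
      rw [intervalIntegral.integral_add_adjacent_intervals (hi 0 z le_rfl hz) (hi z y hz hy),
        intervalIntegral.integral_of_le (hz.trans hy)]
      apply setIntegral_mono_set iS
      · exact Filter.Eventually.of_forall fun t => mul_nonneg (abs_nonneg _) (h.nonneg_right t)
      · exact Ioc_subset_Ioi_self.eventuallyLE
    linarith
  have hlim : Filter.Tendsto (fun y => 2 * cost μ ω (f z) - cost μ ω (f 0) - cost μ ω (f y))
      Filter.atTop (nhds (2 * cost μ ω (f z) - cost μ ω (f 0) - 0)) := by
    apply Filter.Tendsto.const_sub
    have := ((continuous_cost (ω := ω) hμ).tendsto 0).comp h.tendsto_zero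
    rwa [cost_zero] at this
  rw [sub_zero] at hlim
  refine (le_of_tendsto hlim ((Filter.eventually_ge_atTop z).mono hfin)).trans ?_
  apply setIntegral_mono_on iS iE measurableSet_Ioi
  intro x hx
  exact hpt x (le_of_lt hx)

end

/-! ### Parametrisation of soliton values by the phase. -/

/-- The value of the soliton at the point where `tanh` of its phase is `a`. -/
def amplitude (μ ω a : ℝ) : ℝ := height μ ω * (1 - a ^ 2) ^ (1 / (2 * μ))

section

variable {μ ω : ℝ}

theorem continuous_amplitude (hμ : 0 < μ) : Continuous (amplitude μ ω) := by
  have : Continuous fun r : ℝ => r ^ (1 / (2 * μ)) := Real.continuous_rpow_const (by positivity)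
  exact continuous_const.mul (this.comp (by fun_prop))

theorem amplitude_zero : amplitude μ ω 0 = height μ ω := by simp [amplitude]

theorem amplitude_one (hμ : 0 < μ) : amplitude μ ω 1 = 0 := by
  have : (1 / (2 * μ)) ≠ 0 := by positivity
  rw [amplitude, one_pow, sub_self, Real.zero_rpow this, mul_zero]

theorem amplitude_pos (hμ : 0 < μ) (hω : 0 < ω) {a : ℝ} (ha : a ^ 2 < 1) :
    0 < amplitude μ ω a :=
  mul_pos (height_pos hμ hω) (Real.rpow_pos_of_pos (by linarith) _)

theorem amplitude_le_height (hμ : 0 < μ) (hω : 0 < ω) {a : ℝ} (ha : a ^ 2 ≤ 1) :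
    amplitude μ ω a ≤ height μ ω :=
  mul_le_of_le_one_right (height_pos hμ hω).le
    (Real.rpow_le_one (by linarith) (by linarith [sq_nonneg a]) (by positivity))

theorem amplitude_rpow (hμ : 0 < μ) (hω : 0 < ω) {a : ℝ} (ha : a ^ 2 ≤ 1) :
    amplitude μ ω a ^ (2 * μ) = (μ + 1) * ω * (1 - a ^ 2) := by
  rw [amplitude, Real.mul_rpow (height_pos hμ hω).le (Real.rpow_nonneg (by linarith) _),
    height_rpow hμ hω, ← Real.rpow_mul (by linarith), one_div_mul_cancel (by positivity),
    Real.rpow_one]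

theorem amplitude_sq {a : ℝ} (ha : a ^ 2 ≤ 1) :
    amplitude μ ω a ^ 2 = height μ ω ^ 2 * (1 - a ^ 2) ^ (1 / μ) := by
  rw [amplitude, mul_pow, ← Real.rpow_natCast ((1 - a ^ 2) ^ (1 / (2 * μ))),
    ← Real.rpow_mul (by linarith)]
  congr 2
  push_cast
  rw [one_div_mul_eq_div, div_mul_cancel_left₀ two_ne_zero, one_div]

/-- In this parameter the radicand is the perfect square ωa². -/
theorem slope_amplitude (hμ : 0 < μ) (hω : 0 < ω) {a : ℝ} (ha0 : 0 ≤ a) (ha : a ^ 2 ≤ 1) :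
    slope μ ω (amplitude μ ω a) = √ω * a * amplitude μ ω a := by
  rw [slope, amplitude_rpow hμ hω ha]
  have : ω - (μ + 1) * ω * (1 - a ^ 2) / (μ + 1) = ω * a ^ 2 := by
    field_simp; ring
  rw [this, Real.sqrt_mul hω.le, Real.sqrt_sq ha0]
  ring

theorem hasDerivAt_amplitude {a : ℝ} (ha : a ^ 2 < 1) :
    HasDerivAt (amplitude μ ω) (-(a / μ) * height μ ω * (1 - a ^ 2) ^ (1 / (2 * μ) - 1)) a := by
  have h1 : HasDerivAt (fun t : ℝ => 1 - t ^ 2) (-(2 * a)) a := by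
    simpa using (hasDerivAt_pow 2 a).const_sub 1
  have h2 := (h1.rpow_const (p := 1 / (2 * μ)) (Or.inl (by linarith))).const_mul (height μ ω)
  refine h2.congr_deriv ?_
  rw [one_div, mul_inv]
  ring

theorem continuous_one_sub_sq_rpow (hμ : 0 < μ) :
    Continuous fun t : ℝ => (1 - t ^ 2) ^ (1 / μ) := by
  have : Continuous fun r : ℝ => r ^ (1 / μ) := Real.continuous_rpow_const (by positivity)
  exact this.comp (by fun_prop)

/-- In the derivative in `a` the terms containing the derivative of `amplitude` cancel, leaving -√ω
`amplitude`²/2. The left side is the action per edge of the symmetric half-soliton state with α =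
-aN√ω. -/
theorem cost_amplitude_sub (hμ : 0 < μ) (hω : 0 < ω) {a : ℝ} (ha0 : 0 ≤ a) (ha : a ≤ 1) :
    cost μ ω (amplitude μ ω a) - √ω * a * amplitude μ ω a ^ 2 / 2 =
      √ω * height μ ω ^ 2 / 2 * ∫ t in a..1, (1 - t ^ 2) ^ (1 / μ) := by
  have hc := continuous_amplitude (ω := ω) hμ
  have key := intervalIntegral.integral_eq_sub_of_hasDerivAt_of_le ha
    (f := fun t => cost μ ω (amplitude μ ω t) - √ω * t * amplitude μ ω t ^ 2 / 2)
    (f' := fun t => -(√ω * height μ ω ^ 2 / 2 * (1 - t ^ 2) ^ (1 / μ)))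
    (((continuous_cost hμ).comp hc).sub (by fun_prop)).continuousOn
    (fun t ht => by
      have ht1 : t ^ 2 < 1 := by nlinarith [ht.1, ht.2]
      have hd := hasDerivAt_amplitude (μ := μ) (ω := ω) ht1
      have h1 := (hasDerivAt_cost (ω := ω) hμ (amplitude μ ω t)).comp t hd
      have h2 := (((hasDerivAt_id t).const_mul (√ω)).mul (hd.pow 2)).div_const 2
      refine (h1.sub h2).congr_deriv ?_
      rw [slope_amplitude hμ hω (ha0.trans ht.1.le) ht1.le]
      simp only [Pi.pow_apply, id, Nat.cast_ofNat]
      linear_combination -(√ω / 2) * amplitude_sq (μ := μ) (ω := ω) ht1.le)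
    ((continuous_const.mul (continuous_one_sub_sq_rpow hμ)).neg.intervalIntegrable _ _)
  rw [intervalIntegral.integral_neg, intervalIntegral.integral_const_mul, amplitude_one hμ,
    cost_zero] at key
  linarith

end

/-! ### Lower bound for the action on the Nehari manifold. -/

variable {N : ℕ}

theorem normPow_two (Ψ : Fin N → ℝ → ℂ) : normPow 2 Ψ = ∑ j, ∫ x, ‖Ψ j x‖ ^ 2 ∂halfLine := by
  simp [normPow]

/-- Lower bound for the action of `t • Ψ`, as long as it does not exceed the soliton height. -/
theorem le_scaled_action [NeZero N] {μ ω : ℝ} (α : ℝ) (hμ : 0 < μ) (hω : 0 < ω)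
    {Ψ : Fin N → ℝ → ℂ} (hΨ : Ψ ∈ energySpace N) {t : ℝ} (ht : 0 ≤ t)
    (hm : ∀ j x, 0 ≤ x → t * ‖Ψ j x‖ ≤ height μ ω) (i : Fin N) {z : ℝ} (hz : 0 ≤ z) :
    2 * cost μ ω (t * ‖Ψ i z‖) + (N - 2) * cost μ ω (t * ‖Ψ 0 0‖) + α * (t * ‖Ψ 0 0‖) ^ 2 / 2 ≤
      t ^ 2 * (normPow 2 (gradient Ψ) + ω * normPow 2 Ψ + α * ‖Ψ 0 0‖ ^ 2) / 2
        - t ^ (2 * μ + 2) * normPow (2 * μ + 2) Ψ / (2 * μ + 2) := by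
  have hedge : ∀ j y, 0 ≤ y → 2 * cost μ ω (t * ‖Ψ j y‖) - cost μ ω (t * ‖Ψ 0 0‖) ≤
      t ^ 2 * ((∫ x, ‖gradient Ψ j x‖ ^ 2 ∂halfLine) + ω * ∫ x, ‖Ψ j x‖ ^ 2 ∂halfLine) / 2
        - t ^ (2 * μ + 2) * (∫ x, ‖Ψ j x‖ ^ (2 * μ + 2) ∂halfLine) / (2 * μ + 2) := by
    intro j y hy
    have h := ((hΨ.1 j).dominatedVariation.const_mul ht).two_mul_cost_sub_le hμ hω (hm j) hy
    have e : ∀ x, (t * ‖Ψ j x‖) ^ (2 * μ + 2) = t ^ (2 * μ + 2) * ‖Ψ j x‖ ^ (2 * μ + 2) :=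
      fun x => Real.mul_rpow ht (norm_nonneg _)
    simp only [mul_pow, e, integral_const_mul] at h
    rw [hΨ.2 j 0] at h
    refine h.trans (le_of_eq ?_)
    simp only [gradient]
    ring
  -- Edge `i` is tested at `z`; every other edge is tested at the vertex and contributes one `cost`
  -- of the vertex value.
  have hsum := Finset.sum_le_sum fun j (_ : j ∈ Finset.univ) =>
    (show cost μ ω (t * ‖Ψ 0 0‖) +
        (if j = i then 2 * cost μ ω (t * ‖Ψ i z‖) - 2 * cost μ ω (t * ‖Ψ 0 0‖) else 0) ≤ _ by
      split_ifs with hj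
      · subst hj; linarith [hedge j z hz]
      · have := hedge j 0 le_rfl
        rw [hΨ.2 j 0] at this
        linarith : _ ≤ t ^ 2 * ((∫ x, ‖gradient Ψ j x‖ ^ 2 ∂halfLine) +
          ω * ∫ x, ‖Ψ j x‖ ^ 2 ∂halfLine) / 2
        - t ^ (2 * μ + 2) * (∫ x, ‖Ψ j x‖ ^ (2 * μ + 2) ∂halfLine) / (2 * μ + 2))
  rw [Finset.sum_add_distrib, Finset.sum_ite_eq' Finset.univ i, if_pos (Finset.mem_univ i),
    Finset.sum_const, Finset.card_univ, Fintype.card_fin, nsmul_eq_mul, Finset.sum_sub_distrib,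
    ← Finset.sum_div, ← Finset.mul_sum, Finset.sum_add_distrib, ← Finset.mul_sum,
    ← Finset.sum_div, ← Finset.mul_sum] at hsum
  rw [normPow_two, normPow_two, normPow]
  nlinarith [hsum]

/-- Bernoulli's inequality for (t²)^(μ+1). -/
theorem sq_div_two_sub_rpow_div_le {μ t : ℝ} (hμ : 0 < μ) (ht : 0 ≤ t) :
    t ^ 2 / 2 - t ^ (2 * μ + 2) / (2 * μ + 2) ≤ 1 / 2 - 1 / (2 * μ + 2) := by
  have h := one_add_mul_self_le_rpow_one_add (s := t ^ 2 - 1) (by linarith [sq_nonneg t])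
    (p := μ + 1) (by linarith)
  have e : (1 + (t ^ 2 - 1)) ^ (μ + 1) = t ^ (2 * μ + 2) := by
    rw [add_sub_cancel, ← Real.rpow_natCast, ← Real.rpow_mul ht]
    congr 1; push_cast; ring
  rw [e] at h
  have h2 : 0 < 2 * μ + 2 := by linarith
  rw [div_sub_div _ _ two_ne_zero h2.ne', div_sub_div _ _ two_ne_zero h2.ne',
    div_le_div_iff_of_pos_right (by positivity)]
  linarith

/-- On the Nehari manifold the action is maximal along rays. -/
theorem scaled_action_le [NeZero N] {α μ ω : ℝ} (hμ : 0 < μ) {Ψ : Fin N → ℝ → ℂ}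
    (hΨ : Ψ ∈ nehari N α μ ω) {t : ℝ} (ht : 0 ≤ t) :
    t ^ 2 * (normPow 2 (gradient Ψ) + ω * normPow 2 Ψ + α * ‖Ψ 0 0‖ ^ 2) / 2
        - t ^ (2 * μ + 2) * normPow (2 * μ + 2) Ψ / (2 * μ + 2) ≤ action α μ ω Ψ := by
  have hI := hΨ.2.2
  have hB : 0 ≤ normPow (2 * μ + 2) Ψ :=
    Finset.sum_nonneg fun j _ => integral_nonneg fun x => Real.rpow_nonneg (norm_nonneg _) _
  have hA : normPow 2 (gradient Ψ) + ω * normPow 2 Ψ + α * ‖Ψ 0 0‖ ^ 2 = normPow (2 * μ + 2) Ψ := by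
    rw [nehariFunctional] at hI; linarith
  have hS : action α μ ω Ψ = (1 / 2 - 1 / (2 * μ + 2)) * normPow (2 * μ + 2) Ψ := by
    rw [action, energy]
    linear_combination hA / 2
  rw [hA, hS]
  exact (le_of_eq (by ring)).trans
    (mul_le_mul_of_nonneg_right (sq_div_two_sub_rpow_div_le hμ ht) hB)

theorem exists_max_norm [NeZero N] {Ψ : Fin N → ℝ → ℂ} (hΨ : Ψ ∈ energySpace N) :
    ∃ i z, 0 ≤ z ∧ ∀ j x, 0 ≤ x → ‖Ψ j x‖ ≤ ‖Ψ i z‖ := by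
  choose z hz hmax using fun j => (hΨ.1 j).dominatedVariation.exists_max
  obtain ⟨i, -, hi⟩ := Finset.univ.exists_max_image (fun j => ‖Ψ j (z j)‖)
    (Finset.univ_nonempty (α := Fin N))
  exact ⟨i, z i, hz i, fun j x hx => (hmax j x hx).trans (hi j (Finset.mem_univ j))⟩

/-- A state whose vertex value is below the critical one costs at least as much as the
critical symmetric state, provided its maximum is the soliton height. -/
theorem critical_le_of_le {n α μ ω s r : ℝ} (hμ : 0 < μ) (hα : α ≤ 0)
    (hs : 0 < s) (hsm : s ≤ height μ ω)
    (hlevel : n ≤ 2 ∨ n * cost μ ω s + α * s ^ 2 / 2 ≤ 2 * cost μ ω (height μ ω))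
    (hr : 0 ≤ r) (hrs : r ≤ s) :
    n * cost μ ω s + α * s ^ 2 / 2 ≤
      2 * cost μ ω (height μ ω) + (n - 2) * cost μ ω r + α * r ^ 2 / 2 := by
  have h1 := cost_le_cost (ω := ω) hμ hr hrs
  have h2 := cost_le_cost (ω := ω) hμ hs.le hsm
  have h3 : r ^ 2 ≤ s ^ 2 := pow_le_pow_left₀ hr hrs 2
  rcases le_or_gt n 2 with hn | hn
  · nlinarith
  · have h4 := hlevel.resolve_left (not_le.2 hn)
    -- With θ = r²/s² and L the left side, the right side is at least 2 cost(height) + θ(L - 2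
    -- cost(s)), hence at least (1-θ) 2 cost(height) + θL ≥ L.
    have h5 := sq_mul_cost_le (ω := ω) hμ hr hrs
    have hs2 : 0 < s ^ 2 := by positivity
    refine le_of_mul_le_mul_left ?_ hs2
    nlinarith [mul_le_mul_of_nonneg_left h5 (sub_nonneg.2 hn.le),
      mul_le_mul_of_nonneg_left h4 (sub_nonneg.2 h3), mul_le_mul_of_nonneg_left h2 (sq_nonneg r)]

theorem le_action_of_mem_nehari [NeZero N] {α μ ω s : ℝ} (hμ : 0 < μ) (hω : 0 < ω) (hα : α ≤ 0)
    (hs : 0 < s) (hsm : s ≤ height μ ω)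
    (hlevel : (N : ℝ) ≤ 2 ∨ N * cost μ ω s + α * s ^ 2 / 2 ≤ 2 * cost μ ω (height μ ω))
    {Ψ : Fin N → ℝ → ℂ} (hΨ : Ψ ∈ nehari N α μ ω) :
    N * cost μ ω s + α * s ^ 2 / 2 ≤ action α μ ω Ψ := by
  obtain ⟨i, z, hz, hmax⟩ := exists_max_norm hΨ.1
  have hM : 0 < ‖Ψ i z‖ := by
    obtain ⟨j, x, hx, hne⟩ := hΨ.2.1
    exact (norm_pos_iff.2 hne).trans_le (hmax j x hx)
  have hh := height_pos hμ hω
  -- Along the ray, either the vertex modulus reaches `s` no later than the maximum reaches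
  -- `height`, or the maximum gets there first.
  rcases le_or_gt (‖Ψ i z‖ * s) (height μ ω * ‖Ψ 0 0‖) with h | h
  · have hy : 0 < ‖Ψ 0 0‖ := by
      by_contra! hc
      nlinarith [mul_pos hM hs]
    have ht : 0 ≤ s / ‖Ψ 0 0‖ := by positivity
    have hb := le_scaled_action α hμ hω hΨ.1 ht (fun j x hx => by
      rw [div_mul_eq_mul_div, div_le_iff₀ hy]
      nlinarith [hmax j x hx]) 0 (le_refl 0)
    rw [div_mul_cancel₀ _ hy.ne'] at hb
    have := scaled_action_le hμ hΨ ht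
    linarith
  · have ht : 0 ≤ height μ ω / ‖Ψ i z‖ := by positivity
    have hb := le_scaled_action α hμ hω hΨ.1 ht (fun j x hx => by
      rw [div_mul_eq_mul_div, div_le_iff₀ hM]
      nlinarith [hmax j x hx]) i hz
    rw [div_mul_cancel₀ _ hM.ne'] at hb
    have hc := critical_le_of_le hμ hα hs hsm hlevel
      (r := height μ ω / ‖Ψ i z‖ * ‖Ψ 0 0‖) (by positivity)
      (by rw [div_mul_eq_mul_div, div_le_iff₀ hM]; linarith)
    have := scaled_action_le hμ hΨ ht
    linarith

/-! ### The half-soliton. -/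

/-- The phase `tanh (c x + artanh a)`. -/
theorem exists_phase {a c : ℝ} (ha0 : 0 < a) (ha1 : a < 1) (hc : 0 < c) :
    ∃ T : ℝ → ℝ, T 0 = a ∧ (∀ x, HasDerivAt T (c * (1 - T x ^ 2)) x) ∧ (∀ x, T x ^ 2 < 1) ∧
      (∀ x, 0 ≤ x → a ≤ T x) ∧ Filter.Tendsto T Filter.atTop (nhds 1) := by
  -- k = exp(-2 artanh a), so tanh(cx + artanh a) = (1 - E)/(1 + E) with E = k exp(-2cx).
  set k := (1 - a) / (1 + a) with hk
  have hk0 : 0 < k := div_pos (by linarith) (by linarith)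
  set E : ℝ → ℝ := fun x => k * Real.exp (-(2 * c * x)) with hE
  have hE0 : ∀ x, 0 < E x := fun x => mul_pos hk0 (Real.exp_pos _)
  have hE' : ∀ x, HasDerivAt E (-(2 * c) * E x) x := by
    intro x
    have h1 : HasDerivAt (fun x : ℝ => -(2 * c * x)) (-(2 * c)) x := by
      exact ((hasDerivAt_id x).const_mul (2 * c)).neg.congr_deriv (by simp)
    refine (h1.exp.const_mul k).congr_deriv ?_
    simp only [hE]; ring
  have hlim : Filter.Tendsto E Filter.atTop (nhds 0) := by
    have h1 : Filter.Tendsto (fun x : ℝ => -(2 * c * x)) Filter.atTop Filter.atBot :=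
      Filter.tendsto_neg_atTop_atBot.comp
        (Filter.tendsto_id.const_mul_atTop (by positivity : 0 < 2 * c))
    simpa using (Real.tendsto_exp_atBot.comp h1).const_mul k
  refine ⟨fun x => (1 - E x) / (1 + E x), ?_, fun x => ?_, fun x => ?_, fun x hx => ?_, ?_⟩
  · have : E 0 = k := by simp [hE]
    simp only [this, hk]
    have : 1 + a ≠ 0 := by linarith
    field_simp
    ring
  · have hne : 1 + E x ≠ 0 := by linarith [hE0 x]
    refine (((hE' x).const_sub 1).div ((hE' x).const_add 1) hne).congr_deriv ?_
    field_simp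
    ring
  · have h := hE0 x
    simp only
    rw [div_pow, div_lt_one (by positivity)]
    nlinarith
  · have h := hE0 x
    have hEk : E x ≤ k := mul_le_of_le_one_right hk0.le
      (Real.exp_le_one_iff.2 (by have := mul_nonneg hc.le hx; linarith))
    have hka : k * (1 + a) = 1 - a := div_mul_cancel₀ _ (by linarith)
    simp only
    rw [le_div_iff₀ (by linarith)]
    nlinarith
  · have h := (hlim.const_sub 1).div (hlim.const_add 1) (by norm_num)
    rw [sub_zero, add_zero, div_one] at h
    exact h

theorem isWeakDeriv_of_hasDerivAt {φ φ' : ℝ → ℝ} (h : ∀ x, HasDerivAt φ (φ' x) x)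
    (hc : Continuous φ') : IsWeakDeriv (fun x => (φ x : ℂ)) (fun x => (φ' x : ℂ)) := by
  intro η h1 h2 h3
  have hη : IsTest η := ⟨h1, h2, h3⟩
  have hφ : Continuous φ := continuous_iff_continuousAt.2 fun x => (h x).continuousAt
  have hfull : ∀ F ρ : ℝ → ℝ, IsTest ρ → ∫ x in Ioi 0, F x * ρ x = ∫ x, F x * ρ x := by
    intro F ρ hρ
    apply setIntegral_eq_integral_of_forall_compl_eq_zero
    intro y hy
    rw [image_eq_zero_of_notMem_tsupport fun hcon => hy (hρ.tsupport_subset hcon), mul_zero]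
  have hint : ∀ F ρ : ℝ → ℝ, Continuous F → IsTest ρ → Integrable (F * ρ) := fun F ρ hF hρ =>
    (hF.mul hρ.contDiff.continuous).integrable_of_hasCompactSupport hρ.hasCompactSupport.mul_left
  have key := integral_mul_deriv_eq_deriv_mul_of_integrable (u := φ) (u' := φ') (v := η)
    (v' := deriv η) (fun x _ => h x) (fun x _ => (h1.differentiable (by simp) x).hasDerivAt)
    (hint _ _ hφ hη.deriv) (hint _ _ hc hη) (hint _ _ hφ hη)
  simp_rw [← Complex.ofReal_mul, halfLine]
  rw [integral_complex_ofReal, integral_complex_ofReal, hfull _ _ hη.deriv, hfull _ _ hη, key]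
  simp

/-- The half-soliton with vertex value `s = amplitude a` and its first integrals. -/
theorem exists_half_soliton {μ ω a : ℝ} (hμ : 0 < μ) (hω : 0 < ω) (ha0 : 0 < a) (ha1 : a < 1) :
    ∃ u : ℝ → ℂ, MemH1 u ∧ u 0 = (amplitude μ ω a : ℂ) ∧
      (∫ x, ‖weakDeriv u x‖ ^ 2 ∂halfLine) / 2 + ω * (∫ x, ‖u x‖ ^ 2 ∂halfLine) / 2
        - (∫ x, ‖u x‖ ^ (2 * μ + 2) ∂halfLine) / (2 * μ + 2) = cost μ ω (amplitude μ ω a) ∧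
      (∫ x, ‖weakDeriv u x‖ ^ 2 ∂halfLine) + ω * (∫ x, ‖u x‖ ^ 2 ∂halfLine)
        - (∫ x, ‖u x‖ ^ (2 * μ + 2) ∂halfLine) = √ω * a * amplitude μ ω a ^ 2 := by
  have hsω : 0 < √ω := Real.sqrt_pos.2 hω
  obtain ⟨T, hT0, hT', hT1, hTa, hTlim⟩ := exists_phase ha0 ha1 (mul_pos hμ hsω)
  have hTc : Continuous T := continuous_iff_continuousAt.2 fun x => (hT' x).continuousAt
  set φ : ℝ → ℝ := fun x => amplitude μ ω (T x) with hφdef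
  have hφc : Continuous φ := (continuous_amplitude hμ).comp hTc
  have hφ0 : ∀ x, 0 < φ x := fun x => amplitude_pos hμ hω (hT1 x)
  have hφm : ∀ x, φ x ≤ height μ ω := fun x => amplitude_le_height hμ hω (hT1 x).le
  have hφ' : ∀ x, HasDerivAt φ (-(√ω * T x * φ x)) x := by
    intro x
    have hpos : 0 < 1 - T x ^ 2 := by linarith [hT1 x]
    refine ((hasDerivAt_amplitude (hT1 x)).comp x (hT' x)).congr_deriv ?_
    have e : (1 - T x ^ 2) ^ (1 / (2 * μ)) = (1 - T x ^ 2) ^ (1 / (2 * μ) - 1) * (1 - T x ^ 2) := by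
      rw [← Real.rpow_add_one hpos.ne']; congr 1; ring
    simp only [hφdef, amplitude]
    rw [e]
    field_simp
  have hφlim : Filter.Tendsto φ Filter.atTop (nhds 0) := by
    have := ((continuous_amplitude (ω := ω) hμ).tendsto 1).comp hTlim
    rwa [amplitude_one hμ] at this
  -- The derivative has constant sign and `φ` tends to 0, so it is integrable; since `T ≥ a > 0`, it
  -- dominates √ω a φ, whence `φ` is integrable.
  have hd_int : IntegrableOn (fun x => -(√ω * T x * φ x)) (Ioi 0) :=
    integrableOn_Ioi_deriv_of_nonpos' (fun x _ => hφ' x)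
      (fun x hx => by
        have := ha0.trans_le (hTa x (le_of_lt hx))
        have := hφ0 x
        simp only [Left.neg_nonpos_iff]; positivity) hφlim
  have hφint : Integrable φ halfLine := by
    refine Integrable.mono' (hd_int.norm.const_mul (1 / (√ω * a)))
      hφc.aestronglyMeasurable ?_
    filter_upwards [ae_restrict_mem measurableSet_Ioi] with x hx
    have h1 := hTa x (le_of_lt hx)
    have h2 := hφ0 x
    rw [Real.norm_of_nonneg h2.le, norm_neg, Real.norm_of_nonneg (by
      have := ha0.trans_le h1
      positivity), one_div_mul_eq_div, le_div_iff₀ (by positivity)]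
    have := mul_le_mul_of_nonneg_left h1 (mul_pos hsω h2).le
    linarith
  have hbdd : ∀ q : ℝ → ℝ, Continuous q → ∀ C : ℝ, (∀ x, |q x| ≤ C) →
      Integrable (fun x => q x * φ x) halfLine := fun q hq C hC =>
    hφint.bdd_mul hq.aestronglyMeasurable (Filter.Eventually.of_forall hC)
  have hTabs : ∀ x, |T x| ≤ 1 := fun x => (sq_le_one_iff_abs_le_one _).1 (hT1 x).le
  have hφ2 : Integrable (fun x => φ x ^ 2) halfLine := by
    simp_rw [sq]
    exact hbdd φ hφc (height μ ω) fun x => by rw [abs_of_pos (hφ0 x)]; exact hφm x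
  have hd2 : Integrable (fun x => (-(√ω * T x * φ x)) ^ 2) halfLine := by
    have h := hφ2.const_mul ω
    refine Integrable.mono' h (by fun_prop) (Filter.Eventually.of_forall fun x => ?_)
    rw [Real.norm_of_nonneg (sq_nonneg _), neg_sq, mul_pow, mul_pow, Real.sq_sqrt hω.le]
    have := (hT1 x).le
    have h3 := mul_nonneg hω.le (sq_nonneg (φ x))
    nlinarith
  have hd_c : Continuous fun x => -(√ω * T x * φ x) := by fun_prop
  have hw := isWeakDeriv_of_hasDerivAt hφ' hd_c
  have hmem : MemLp (fun x => ((-(√ω * T x * φ x) : ℝ) : ℂ)) 2 halfLine :=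
    ((memLp_two_iff_integrable_sq hd_c.aestronglyMeasurable).2 hd2).ofReal
  have hH1 : MemH1 (fun x => (φ x : ℂ)) :=
    ⟨(Complex.continuous_ofReal.comp hφc).continuousOn,
      ((memLp_two_iff_integrable_sq hφc.aestronglyMeasurable).2 hφ2).ofReal, _, hmem, hw⟩
  have hp : (2:ℝ) ≤ 2 * μ + 2 := by linarith
  have hnorm : ∀ x, ‖(φ x : ℂ)‖ = φ x := fun x => by
    rw [Complex.norm_real, Real.norm_of_nonneg (hφ0 x).le]
  have hφp : Integrable (fun x => φ x ^ (2 * μ + 2)) halfLine := by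
    have := hH1.dominatedVariation.integrable_rpow hp
    simpa only [hnorm] using this
  have hgrad : ∫ x, ‖weakDeriv (fun x => (φ x : ℂ)) x‖ ^ 2 ∂halfLine =
      ∫ x, (-(√ω * T x * φ x)) ^ 2 ∂halfLine := by
    apply integral_congr_ae
    filter_upwards [weakDeriv_ae_eq hmem hw] with x hx
    rw [hx, Complex.norm_real, Real.norm_eq_abs, sq_abs]
  refine ⟨fun x => (φ x : ℂ), hH1, by simp [hφdef, hT0], ?_, ?_⟩
  · simp only [hnorm]
    rw [hgrad]
    -- Since φ' = -slope(φ), the energy density is exactly the derivative of -cost(φ).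
    have hF := integral_Ioi_of_hasDerivAt_of_tendsto' (a := (0:ℝ)) (m := 0)
      (f := fun x => -cost μ ω (φ x))
      (f' := fun x => (-(√ω * T x * φ x)) ^ 2 / 2 + ω * φ x ^ 2 / 2
        - φ x ^ (2 * μ + 2) / (2 * μ + 2))
      (fun x hx => by
        have hT := ha0.le.trans (hTa x hx)
        refine ((hasDerivAt_cost (ω := ω) hμ (φ x)).comp x (hφ' x)).neg.congr_deriv ?_
        have h1 := slope_sq hμ hω (hφ0 x).le (hφm x)
        have h2 : slope μ ω (φ x) = √ω * T x * φ x := slope_amplitude hμ hω hT (hT1 x).le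
        rw [h2] at h1 ⊢
        linear_combination h1)
      (show Integrable _ halfLine from
        ((hd2.div_const 2).add ((hφ2.const_mul ω).div_const 2)).sub (hφp.div_const _))
      (by
        have := (((continuous_cost (ω := ω) hμ).tendsto 0).comp hφlim).neg
        rwa [cost_zero, neg_zero] at this)
    rw [show φ 0 = amplitude μ ω a by simp [hφdef, hT0]] at hF
    rw [zero_sub, neg_neg] at hF
    rw [← hF]
    change _ = ∫ x, _ ∂halfLine
    rw [integral_sub, integral_add, integral_div, integral_div, integral_div, integral_const_mul]
    · exact hd2.div_const 2
    · exact (hφ2.const_mul ω).div_const 2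
    · exact (hd2.div_const 2).add ((hφ2.const_mul ω).div_const 2)
    · exact hφp.div_const _
  · simp only [hnorm]
    rw [hgrad]
    -- The density is the derivative of φφ' = -√ω T φ², by the stationary equation φ'' = ωφ -
    -- φ^(2μ+1).
    have hF := integral_Ioi_of_hasDerivAt_of_tendsto' (a := (0:ℝ)) (m := 0)
      (f := fun x => -(√ω * T x * φ x ^ 2))
      (f' := fun x => (-(√ω * T x * φ x)) ^ 2 + ω * φ x ^ 2 - φ x ^ (2 * μ + 2))
      (fun x hx => by
        refine (((hT' x).const_mul (√ω)).mul ((hφ' x).pow 2)).neg.congr_deriv ?_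
        have h1 : φ x ^ (2 * μ) = (μ + 1) * ω * (1 - T x ^ 2) := amplitude_rpow hμ hω (hT1 x).le
        rw [rpow_two_mul_add_two (hφ0 x).le hμ, h1]
        simp only [Pi.pow_apply, Nat.cast_ofNat]
        linear_combination (-μ * (1 - T x ^ 2) * φ x ^ 2 + T x ^ 2 * φ x ^ 2) *
          Real.sq_sqrt hω.le)
      (show Integrable _ halfLine from (hd2.add (hφ2.const_mul ω)).sub hφp)
      (by
        have := (((hTlim.const_mul (√ω)).mul (hφlim.pow 2))).neg
        simpa using this)
    rw [show φ 0 = amplitude μ ω a by simp [hφdef, hT0], hT0] at hF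
    rw [zero_sub, neg_neg] at hF
    rw [← hF]
    change _ = ∫ x, _ ∂halfLine
    rw [integral_sub, integral_add, integral_const_mul]
    · exact hd2
    · exact hφ2.const_mul ω
    · exact hd2.add (hφ2.const_mul ω)
    · exact hφp

/-! ### Attainment and the threshold. -/

/-- The minimizer is the half-soliton on every edge. Its Nehari functional is (N√ω a + α)s², which
forces this value of α. -/
theorem exists_isLeast_action [NeZero N] {μ ω a : ℝ} (hμ : 0 < μ) (hω : 0 < ω) (ha0 : 0 < a)
    (ha1 : a < 1)
    (hlevel : 3 ≤ N → (N / 2 : ℝ) * ∫ t in a..1, (1 - t ^ 2) ^ (1 / μ) ≤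
      ∫ t in (0:ℝ)..1, (1 - t ^ 2) ^ (1 / μ)) :
    ∃ Ψ ∈ nehari N (-(a * (N * √ω))) μ ω,
      IsLeast (action (-(a * (N * √ω))) μ ω '' nehari N (-(a * (N * √ω))) μ ω)
        (action (-(a * (N * √ω))) μ ω Ψ) := by
  have hsω : 0 < √ω := Real.sqrt_pos.2 hω
  have ha2 : a ^ 2 < 1 := by nlinarith
  have hs := amplitude_pos hμ hω ha2
  obtain ⟨u, hu, hu0, hE, hI⟩ := exists_half_soliton hμ hω ha0 ha1
  have hΨ0 : ‖u 0‖ = amplitude μ ω a := by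
    rw [hu0, Complex.norm_real, Real.norm_of_nonneg hs.le]
  have hmem : (fun _ => u : Fin N → ℝ → ℂ) ∈ nehari N (-(a * (N * √ω))) μ ω := by
    refine ⟨⟨fun _ => hu, fun _ _ => rfl⟩, ⟨0, 0, le_rfl, ?_⟩, ?_⟩
    · rw [← norm_pos_iff, hΨ0]; exact hs
    · rw [nehariFunctional, normPow_two, normPow_two, normPow]
      simp only [gradient, Finset.sum_const, Finset.card_univ, Fintype.card_fin, nsmul_eq_mul, hΨ0]
      linear_combination (N : ℝ) * hI
  have haction : action (-(a * (N * √ω))) μ ω (fun _ => u : Fin N → ℝ → ℂ) =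
      N * cost μ ω (amplitude μ ω a) + -(a * (N * √ω)) * amplitude μ ω a ^ 2 / 2 := by
    rw [action, energy, normPow_two, normPow_two, normPow]
    simp only [gradient, Finset.sum_const, Finset.card_univ, Fintype.card_fin, nsmul_eq_mul, hΨ0]
    linear_combination (N : ℝ) * hE
  refine ⟨_, hmem, mem_image_of_mem _ hmem, ?_⟩
  rintro _ ⟨Φ, hΦ, rfl⟩
  rw [haction]
  refine le_action_of_mem_nehari hμ hω (neg_nonpos.2 (by positivity)) hs
    (amplitude_le_height hμ hω ha2.le) ?_ hΦ
  rcases lt_or_ge N 3 with hN | hN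
  · left
    exact_mod_cast Nat.lt_succ_iff.1 hN
  · right
    have h1 := cost_amplitude_sub hμ hω ha0.le ha1.le
    have h2 := cost_amplitude_sub hμ hω le_rfl zero_le_one
    rw [amplitude_zero] at h2
    have h3 := mul_le_mul_of_nonneg_left (hlevel hN)
      (show 0 ≤ √ω * height μ ω ^ 2 by positivity)
    nlinarith

/-- The tail integral is continuous in its lower limit and 0 at 1, so it takes the value 2/n times
the full integral; `2 < n` keeps the solution away from 0. -/
theorem exists_threshold {μ n : ℝ} (hμ : 0 < μ) (hn : 2 < n) :
    ∃ a, 0 < a ∧ a < 1 ∧ ∫ t in (0:ℝ)..1, (1 - t ^ 2) ^ (1 / μ) =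
      n / 2 * ∫ t in a..1, (1 - t ^ 2) ^ (1 / μ) := by
  have hc := continuous_one_sub_sq_rpow hμ
  set F : ℝ → ℝ := fun x => ∫ t in x..1, (1 - t ^ 2) ^ (1 / μ) with hF
  have hFc : Continuous F := by
    have h := intervalIntegral.continuous_primitive (μ := volume) (fun a b => hc.intervalIntegrable a b) 1
    have e : F = fun x => -∫ t in (1:ℝ)..x, (1 - t ^ 2) ^ (1 / μ) :=
      funext fun x => intervalIntegral.integral_symm _ _
    rw [e]; exact h.neg
  have hF1 : F 1 = 0 := intervalIntegral.integral_same
  have hF0 : 0 < F 0 := by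
    apply intervalIntegral.intervalIntegral_pos_of_pos_on (hc.intervalIntegrable _ _) _ zero_lt_one
    intro t ht
    exact Real.rpow_pos_of_pos (by nlinarith [ht.1, ht.2]) _
  have hn0 : 0 < n := by linarith
  have hlt : 2 / n * F 0 < F 0 := by
    have : 2 / n < 1 := (div_lt_one hn0).2 hn
    nlinarith
  have hpos : 0 < 2 / n * F 0 := by positivity
  obtain ⟨a, ha, hFa⟩ := intermediate_value_Icc' zero_le_one hFc.continuousOn
    (show 2 / n * F 0 ∈ Icc (F 1) (F 0) from ⟨by rw [hF1]; exact hpos.le, hlt.le⟩)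
  refine ⟨a, lt_of_le_of_ne ha.1 ?_, lt_of_le_of_ne ha.2 ?_, ?_⟩
  · rintro rfl; exact hlt.ne hFa.symm
  · rintro rfl; rw [hF1] at hFa; exact hpos.ne hFa
  · change F 0 = n / 2 * F a
    rw [hFa]; field_simp

theorem integral_one_sub_sq_rpow_anti {μ a b : ℝ} (hμ : 0 < μ) (ha : 0 ≤ a) (hab : a ≤ b)
    (hb : b ≤ 1) :
    ∫ t in b..1, (1 - t ^ 2) ^ (1 / μ) ≤ ∫ t in a..1, (1 - t ^ 2) ^ (1 / μ) := by
  have hc := continuous_one_sub_sq_rpow hμ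
  rw [← intervalIntegral.integral_add_adjacent_intervals (hc.intervalIntegrable a b)
    (hc.intervalIntegrable b 1)]
  refine le_add_of_nonneg_left (intervalIntegral.integral_nonneg hab fun t ht => ?_)
  exact Real.rpow_nonneg (by nlinarith [ht.1, ht.2]) _

end StarGraph

end

theorem theorem1 (N : ℕ) [NeZero N] (μ ω : ℝ) (hμ : 0 < μ) (hω : 0 < ω) :
    ∃ αstar : ℝ, -(N * Real.sqrt ω) < αstar ∧ αstar < 0 ∧
      (3 ≤ N →
        ∫ t in (0 : ℝ)..1, (1 - t ^ 2) ^ (1 / μ) =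
          (N / 2 : ℝ) * ∫ t in (|αstar| / (N * Real.sqrt ω))..1, (1 - t ^ 2) ^ (1 / μ)) ∧
      ∀ α : ℝ, -(N * Real.sqrt ω) < α → α < αstar →
        ∃ Ψ ∈ StarGraph.nehari N α μ ω,
          IsLeast (StarGraph.action α μ ω '' StarGraph.nehari N α μ ω)
            (StarGraph.action α μ ω Ψ) := by
  have hK : 0 < N * Real.sqrt ω :=
    mul_pos (Nat.cast_pos.2 (NeZero.pos N)) (Real.sqrt_pos.2 hω)
  obtain ⟨a, ha0, ha1, ha⟩ : ∃ a : ℝ, 0 < a ∧ a < 1 ∧ (3 ≤ N →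
      ∫ t in (0 : ℝ)..1, (1 - t ^ 2) ^ (1 / μ) =
        (N / 2 : ℝ) * ∫ t in a..1, (1 - t ^ 2) ^ (1 / μ)) := by
    by_cases hN : 3 ≤ N
    · obtain ⟨a, h0, h1, h⟩ := StarGraph.exists_threshold (n := N) hμ (by
        exact_mod_cast (show 2 < N by omega))
      exact ⟨a, h0, h1, fun _ => h⟩
    -- For N ≤ 2 there is no level condition; any value in (0, 1) would do.
    · exact ⟨1 / 2, by norm_num, by norm_num, fun h => absurd h hN⟩
  refine ⟨-(a * (N * Real.sqrt ω)), by nlinarith, by nlinarith, fun hN => ?_, fun α hα hα' => ?_⟩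
  · rw [abs_neg, abs_of_pos (mul_pos ha0 hK), mul_div_cancel_right₀ _ hK.ne']
    exact ha hN
  -- A more negative α means a larger parameter `b`, whose tail integral is smaller, so the level
  -- condition persists.
  · obtain ⟨b, rfl⟩ : ∃ b, α = -(b * (N * Real.sqrt ω)) :=
      ⟨-α / (N * Real.sqrt ω), by rw [div_mul_cancel₀ _ hK.ne', neg_neg]⟩
    have hab : a < b := by
      by_contra! hcon
      nlinarith
    have hb1 : b < 1 := by
      by_contra! hcon
      nlinarith
    refine StarGraph.exists_isLeast_action hμ hω (ha0.trans hab) hb1 fun hN => ?_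
    rw [ha hN]
    exact mul_le_mul_of_nonneg_left
      (StarGraph.integral_one_sub_sq_rpow_anti hμ ha0.le hab.le hb1.le) (by positivity)
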